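/- **Definitions.** Let $T$ be a locally finite rooted tree, $\partial T$ its boundary (infinite rays from the root, with the topology of pointwise convergence), and $\mathrm{Aut}(T)$ the group of automorphisms fixing the root. For $G\le \mathrm{Aut}(T)$ and a vertex $v$, let $\mathrm{Rist}_G(v)$ be the subgroup of the elements of $G$ that fix every vertex not below $v$, and let $\mathrm{Rist}_G(n)$ be the subgroup generated by all $\mathrm{Rist}_G(v)$ with $v$ at distance $n$ from the root. The group $G$ is a *branch group* if it acts transitively on each level of $T$ and $\mathrm{Rist}_G(n)$ has finite index in $G$ for every $n\ge 1$. If $G$ acts by homeomorphisms on a compact space $X$, the *essential support* of the action is the closed $G$-invariant set $Y=\bigcap_{n\ge1}\mathrm{supp}_X(\mathrm{Rist}_G(n)')$, where $K'$ denotes the derived subgroup of $K$ and $\mathrm{supp}_X(K)$ is the closure of the set of points of $X$ not fixed by $K$. For a group $H$ acting by homeomorphisms on $X$ and generated by a finite symmetric set $S$, and for $x\in X$, let $H_x^0$ be the subgroup of the elements of $H$ that fix a neighbourhood of $x$ pointwise. The *graph of germs* $\widetilde\Gamma(H,x)$ is the graph with vertex set $H/H_x^0$ and edges joining $c$ to $sc$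 for $c \in H/H^0_x$ and $s\in S$. The *Lipschitz euclidean dimension* $\mathrm{leud}(\Gamma)\in[0,\infty]$ of a graph $\Gamma$ of bounded degree is the supremum of all $k\in\mathbb N$ for which there is a Lipschitz map $\mathbb N^k\to\Gamma$ whose fibres have uniformly bounded cardinality. For a compact space $Z$ let $Z^{[d]}$ be the space of non-empty subsets of $Z$ with at most $d$ elements, with the Hausdorff topology, so that $Z^{[1]}=Z$. A map $q\colon Y\to Z^{[d]}$ is *upper semi-continuous* if $\{y\in Y: q(y)\cap K=\varnothing\}$ is open in $Y$ for every compact $K\subseteq Z$. **Theorem.** Let $G\le \mathrm{Aut}(T)$ be a finitely generated branch group. Let $X$ be a compact space, let $H\le \mathrm{Homeo}(X)$ be a group generated by a finite symmetric set $S$, and let $d\in\mathbb N$ be such that $\sup_{x\in X}\mathrm{leud}(\widetilde\Gamma(H,x))\le d$. Let $\rho\colon G\to H$ be an injective homomorphism, and let $Y\subseteq X$ be the essential support of the action of $G$ on $X$ induced by $\rho$. Then there exists an upper semi-continuous $G$-equivariant map $q\colon Y\to \partial T^{[d]}$. Moreover, if $d=1$, then the map $q\colon Y\to\partial T^{[1]}=\partial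 T$ is continuous. -/

import Mathlib

open Topology

/-! ## Actions, germs, graphs -/

section Actions

variable {Γ X : Type*} [Group Γ]

/-- The germ-stabiliser of `x`, for the action of `Γ` on `X` given by `φ`: the elements fixing
pointwise a neighbourhood of `x`. -/
def germStabilizer [TopologicalSpace X] (φ : Γ →* (X ≃ₜ X)) (x : X) : Subgroup Γ where
  carrier := {g | ∀ᶠ y in 𝓝 x, φ g y = y}
  one_mem' := by
    refine Filter.Eventually.of_forall fun y => ?_
    rw [map_one]
    rfl
  mul_mem' := by
    intro a b ha hb
    filter_upwards [ha, hb] with y hya hyb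
    rw [map_mul]
    change φ a (φ b y) = y
    rw [hyb, hya]
  inv_mem' := by
    intro a ha
    filter_upwards [ha] with y hy
    rw [map_inv]
    exact (φ a).toEquiv.symm_apply_eq.2 hy.symm

/-- The graph of the action of `Γ` on `Ω` with respect to `S ⊆ Γ`: each `a` is joined to `s • a`,
`s ∈ S`. Loops and multiplicities of edges, which do not affect distances, are discarded. -/
def actionGraph (S : Set Γ) (Ω : Type*) [MulAction Γ Ω] : SimpleGraph Ω :=
  SimpleGraph.fromRel fun a b => ∃ s ∈ S, s • a = b

/-- The graph of germs at `x` of the action of `Γ` given by `φ`: the graph of the left action of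
`Γ` on the cosets of the germ-stabiliser of `x`. -/
def graphOfGerms [TopologicalSpace X] (φ : Γ →* (X ≃ₜ X)) (S : Set Γ) (x : X) :
    SimpleGraph (Γ ⧸ germStabilizer φ x) :=
  actionGraph S (Γ ⧸ germStabilizer φ x)

/-- The closed support of the subgroup `K`, for the action on `X` given by `φ`: the closure of the
complement of the set of points fixed by `K`. -/
def closedSupport [TopologicalSpace X] (φ : Γ →* (X ≃ₜ X)) (K : Subgroup Γ) : Set X :=
  closure {x | ∀ k ∈ K, φ k x = x}ᶜ

theorem closedSupport_mapsTo [TopologicalSpace X] (φ : Γ →* (X ≃ₜ X)) (K : Subgroup Γ) [K.Normal]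
    (g : Γ) {x : X} (hx : x ∈ closedSupport φ K) : φ g x ∈ closedSupport φ K := by
  refine map_mem_closure (φ g).continuous hx ?_
  intro y hy h
  refine hy fun k hk => ?_
  have h1 := h (g * k * g⁻¹) (Subgroup.Normal.conj_mem ‹_› k hk g)
  have h2 : φ (g * k * g⁻¹) (φ g y) = φ g (φ k y) := by
    change (φ (g * k * g⁻¹) * φ g) y = (φ g * φ k) y
    rw [← map_mul, ← map_mul, inv_mul_cancel_right]
  exact (φ g).injective (h2.symm.trans h1)

end Actions

/-! ## Lipschitz euclidean dimension -/

/-- `f : ℕ^d → V` is Lipschitz, where `ℕ^d` has its graph metric (the `ℓ¹` metric) and `V` the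
graph metric of `Δ` (infinite between distinct components), and its fibres have uniformly bounded
cardinality. -/
def IsLipschitzBoundedFibres {V : Type*} (Δ : SimpleGraph V) (d : ℕ) (f : (Fin d → ℕ) → V) :
    Prop :=
  (∃ C : ℕ, ∀ m n : Fin d → ℕ,
    Δ.edist (f m) (f n) ≤ ((C * ∑ i, Nat.dist (m i) (n i) : ℕ) : ℕ∞)) ∧
  ∃ k : ℕ, ∀ v : V, (f ⁻¹' {v}).encard ≤ (k : ℕ∞)

/-- The Lipschitz euclidean dimension of a graph: the supremum in `[0, ∞]` of all `d` such that
there is a Lipschitz map `ℕ^d → Δ` with fibres of uniformly bounded cardinality. -/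
noncomputable def leud {V : Type*} (Δ : SimpleGraph V) : ℕ∞ :=
  ⨆ (d : ℕ) (_ : ∃ f : (Fin d → ℕ) → V, IsLipschitzBoundedFibres Δ d f), (d : ℕ∞)

/-! ## Rooted trees and their automorphisms -/

/-- A locally finite rooted tree with vertex set `V`. -/
structure LFRootedTree (V : Type*) where
  graph : SimpleGraph V
  isTree : graph.IsTree
  locallyFinite : ∀ v, (graph.neighborSet v).Finite
  root : V

namespace LFRootedTree

variable {V : Type*} (T : LFRootedTree V)

/-- The group of automorphisms of the tree fixing the root. -/
def Aut : Subgroup (T.graph ≃g T.graph) where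
  carrier := {g | g T.root = T.root}
  one_mem' := rfl
  mul_mem' := by
    intro a b ha hb
    change a (b T.root) = T.root
    rw [show b T.root = T.root from hb, show a T.root = T.root from ha]
  inv_mem' := by
    intro a ha
    change a.symm T.root = T.root
    rw [RelIso.symm_apply_eq]
    exact (show a T.root = T.root from ha).symm

/-- The natural action of the automorphism group on the vertices. -/
instance : MulAction T.Aut V where
  smul g v := g.1 v
  one_smul _ := rfl
  mul_smul _ _ _ := rfl

/-- The vertices at distance `n` from the root. -/
def level (n : ℕ) : Set V := {v | T.graph.dist T.root v = n}

/-- `T.Below v w`: the vertex `w` is below `v`, that is, `v` lies on the geodesic from the root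
to `w`. -/
def Below (v w : V) : Prop :=
  T.graph.dist T.root v + T.graph.dist v w = T.graph.dist T.root w

/-- The boundary of the tree: the rays (sequences of pairwise distinct, successively adjacent
vertices) starting at the root. -/
def Boundary : Type _ :=
  {ξ : ℕ → V // ξ 0 = T.root ∧ (∀ n, T.graph.Adj (ξ n) (ξ (n + 1))) ∧ Function.Injective ξ}

/-- The topology of the boundary, in which two rays are close if they agree for a long time: it
is induced by the product of the discrete topologies. -/
instance : TopologicalSpace T.Boundary :=
  TopologicalSpace.induced Subtype.val (@Pi.topologicalSpace ℕ (fun _ => V) fun _ => ⊥)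

/-- The action on the boundary, moving rays vertex by vertex. -/
instance : MulAction T.Aut T.Boundary where
  smul g ξ := ⟨fun n => g • ξ.1 n, by
    refine ⟨?_, fun n => ?_, fun m n h => ?_⟩
    · change g.1 (ξ.1 0) = T.root
      rw [ξ.2.1]
      exact g.2
    · exact g.1.map_rel_iff.2 (ξ.2.2.1 n)
    · exact ξ.2.2.2 (g.1.injective h)⟩
  one_smul _ := rfl
  mul_smul _ _ _ := rfl

variable {T} (G : Subgroup T.Aut)

/-- The rigid stabiliser in `G` of the vertex `v`: the elements of `G` fixing all the vertices
that are not below `v`. -/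
def rist (v : V) : Subgroup G where
  carrier := {g | ∀ w, ¬ T.Below v w → g • w = w}
  one_mem' := fun w _ => one_smul G w
  mul_mem' := by
    intro a b ha hb w hw
    rw [mul_smul, hb w hw, ha w hw]
  inv_mem' := by
    intro a ha w hw
    rw [inv_smul_eq_iff, ha w hw]

/-- The rigid stabiliser in `G` of level `n`, generated by those of the vertices of level `n`. -/
def ristLevel (n : ℕ) : Subgroup G := ⨆ v ∈ T.level n, rist G v

/-- `G` acts transitively on every level. -/
def IsLevelTransitive : Prop :=
  ∀ n, ∀ v ∈ T.level n, ∀ w ∈ T.level n, ∃ g : G, g • v = w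

/-- `G` is a branch group. -/
def IsBranch : Prop :=
  IsLevelTransitive G ∧ ∀ n, 1 ≤ n → (ristLevel G n).FiniteIndex

/-- The essential support of the action of `G` on `X` given by `φ`: the intersection over `n ≥ 1`
of the supports of the derived subgroups of the level rigid stabilisers. -/
def essentialSupport {X : Type*} [TopologicalSpace X] (φ : G →* (X ≃ₜ X)) : Set X :=
  ⋂ (n : ℕ) (_ : 1 ≤ n), closedSupport φ ⁅ristLevel G n, ristLevel G n⁆

variable {G}

theorem dist_smul (g : G) (v w : V) :
    T.graph.dist (g • v) (g • w) = T.graph.dist v w := by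
  have key : ∀ (h : T.graph ≃g T.graph) (a b : V),
      T.graph.dist (h a) (h b) ≤ T.graph.dist a b := by
    intro h a b
    obtain ⟨p, hp⟩ := T.isTree.connected.exists_walk_length_eq_dist a b
    rw [← hp, ← SimpleGraph.Walk.length_map h.toHom p]
    exact SimpleGraph.dist_le _
  refine le_antisymm (key g.1.1 v w) ?_
  have h := key g.1.1.symm (g • v) (g • w)
  have e : ∀ a : V, g.1.1.symm (g • a) = a := fun a => g.1.1.symm_apply_apply a
  rwa [e, e] at h

theorem root_smul (g : G) : g • T.root = T.root := g.1.2

theorem dist_root_smul (g : G) (v : V) :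
    T.graph.dist T.root (g • v) = T.graph.dist T.root v := by
  conv_lhs => rw [← root_smul g]
  exact dist_smul g _ _

theorem below_smul_iff (g : G) (v w : V) : T.Below (g • v) (g • w) ↔ T.Below v w := by
  simp only [Below, dist_root_smul, dist_smul]

instance ristLevel_normal (n : ℕ) : (ristLevel G n).Normal where
  conj_mem k hk g := by
    suffices h : ristLevel G n ≤ (ristLevel G n).comap (MulAut.conj g).toMonoidHom from h hk
    refine iSup₂_le fun v hv a ha => ?_
    change g * a * g⁻¹ ∈ ristLevel G n
    refine (le_iSup₂ (f := fun v (_ : v ∈ T.level n) => rist G v) (g • v)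
      ((dist_root_smul g v).trans hv)) fun w hw => ?_
    have hw' : ¬ T.Below v (g⁻¹ • w) := by
      rwa [← below_smul_iff g, smul_inv_smul]
    rw [mul_smul, mul_smul, ha _ hw', smul_inv_smul]

/-- The essential support is invariant. -/
theorem essentialSupport_mapsTo {X : Type*} [TopologicalSpace X] (φ : G →* (X ≃ₜ X)) (g : G)
    {x : X} (hx : x ∈ essentialSupport G φ) : φ g x ∈ essentialSupport G φ := by
  simp only [essentialSupport, Set.mem_iInter] at hx ⊢
  exact fun n hn => closedSupport_mapsTo φ _ g (hx n hn)

end LFRootedTree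

/-! ## Configurations and semi-continuity -/

/-- The space of configurations of at most `d` points of `Z`: the non-empty finite subsets of
cardinality at most `d`. -/
def Config (Z : Type*) (d : ℕ) : Type _ :=
  {C : Set Z // C.Nonempty ∧ C.encard ≤ (d : ℕ∞)}

/-- The Hausdorff topology: the sets of `C` disjoint from a given compact set, and the sets of `C`
meeting a given open set, form a subbasis. -/
instance {Z : Type*} [TopologicalSpace Z] {d : ℕ} : TopologicalSpace (Config Z d) :=
  TopologicalSpace.generateFrom
    ({A | ∃ K : Set Z, IsCompact K ∧ A = {C | C.1 ∩ K = ∅}} ∪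
      {A | ∃ U : Set Z, IsOpen U ∧ A = {C | (C.1 ∩ U).Nonempty}})

/-- Upper semi-continuity of a map with values in configurations: for every compact `K`, the set
of points whose value is disjoint from `K` is open. -/
def Config.IsUpperSemicontinuous {Y Z : Type*} [TopologicalSpace Y] [TopologicalSpace Z] {d : ℕ}
    (q : Y → Config Z d) : Prop :=
  ∀ K : Set Z, IsCompact K → IsOpen {y | (q y).1 ∩ K = ∅}

/-! To a point y attach the set of rays ξ such that y lies in the support of Rist(ξ_n)' for every n
(`supportRays`). Levels are finite and Rist(n)' lies in the join of the Rist(v)', so a point of the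
essential support lies in the support of some Rist(v)' at every level n ≥ 1, and Kőnig's lemma
yields a ray. Equivariance is formal, and the relation between y and ξ is closed, which gives upper
semi-continuity. The substance is that k such rays force leud ≥ k at y (`le_leud_graphOfGerms`).

Let K be the group of elements of G with trivial germ at y, and let v_i be the vertices of the k
rays at a level separating them. Project the part of K in Rist(v_i) × (fixer of the vertices below
v_i) to Rist(v_i). If all these images have infinite index, the commuting finitely generated groups
Rist(v_i) each carry a ray of distinct cosets, and the product of these rays is an injective
Lipschitz map from ℕ^k to the graph of germs (`le_leud_of_commuting`).

Otherwise fix a ray ξ whose image has finite index. If K meets some Rist(ξ_m) trivially, then k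
incomparable vertices below ξ_m give commuting infinite groups whose product acts freely on the germ
at y, and the same construction applies. If K meets them all nontrivially, the double commutator
trick puts some Rist(ξ_m)' inside a subgroup generated by finitely many elements of K
(`exists_finite_commutator_rist_le`). Such a subgroup fixes a neighbourhood of y, so y is outside
the support of Rist(ξ_m)', a contradiction. -/

namespace SimpleGraph

/-! ### Geodesic rays in locally finite graphs -/

variable {W : Type*} {Δ : SimpleGraph W}

/-- A neighbour of `v` on a geodesic from `v` to `a ≠ v`. -/
theorem Connected.exists_adj_dist_add_one (hc : Δ.Connected) {v a : W} (h : v ≠ a) :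
    ∃ w, Δ.Adj v w ∧ Δ.dist v a = Δ.dist w a + 1 := by
  obtain ⟨p, hp⟩ := hc.exists_walk_length_eq_dist v a
  cases p with
  | nil => exact absurd rfl h
  | @cons _ w _ hvw p =>
    refine ⟨w, hvw, le_antisymm ?_ ?_⟩
    · have := hc.dist_triangle (u := v) (v := w) (w := a)
      rw [dist_eq_one_iff_adj.2 hvw] at this
      omega
    · rw [← hp, Walk.length_cons]
      exact Nat.succ_le_succ (dist_le p)

/-- **Kőnig's lemma**: an infinite set of vertices of a connected locally finite graph is
accumulated by a geodesic ray. -/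
theorem Connected.exists_geodesic_ray (hc : Δ.Connected) (hf : ∀ v, (Δ.neighborSet v).Finite)
    (o : W) {A : Set W} (hA : A.Infinite) :
    ∃ c : ℕ → W, c 0 = o ∧ (∀ n, Δ.Adj (c n) (c (n + 1))) ∧ (∀ n, Δ.dist o (c n) = n) ∧
      ∀ n, ∃ a ∈ A, Δ.dist o (c n) + Δ.dist (c n) a = Δ.dist o a := by
  let D : W → Set W := fun v => {a ∈ A | Δ.dist o v + Δ.dist v a = Δ.dist o a}
  have step : ∀ v, (D v).Infinite →
      ∃ w, Δ.Adj v w ∧ Δ.dist o w = Δ.dist o v + 1 ∧ (D w).Infinite := by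
    intro v hv
    by_contra! hcon
    -- A point of `D v` other than `v` is in `D w` for one of the finitely many neighbours `w` that
    -- are one step further from `o`.
    have hcover : D v ⊆ {v} ∪ ⋃ w ∈ {w ∈ Δ.neighborSet v | Δ.dist o w = Δ.dist o v + 1}, D w := by
      rintro a ⟨haA, ha⟩
      rcases eq_or_ne v a with rfl | hva
      · exact Or.inl rfl
      · obtain ⟨w, hvw, hd⟩ := hc.exists_adj_dist_add_one hva
        have h1 := hc.dist_triangle (u := o) (v := v) (w := w)
        have h2 := hc.dist_triangle (u := o) (v := w) (w := a)
        rw [dist_eq_one_iff_adj.2 hvw] at h1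
        refine Or.inr (Set.mem_biUnion (x := w) ⟨hvw, by omega⟩ ⟨haA, by omega⟩)
    refine hv (((Set.finite_singleton v).union
      (((hf v).subset (Set.sep_subset _ _)).biUnion ?_)).subset hcover)
    rintro w ⟨hvw, hw⟩
    exact hcon w hvw hw
  choose f hf1 hf2 hf3 using step
  have h0 : (D o).Infinite := by
    convert hA using 1
    ext a
    simp [D]
  let c : ℕ → {v // (D v).Infinite} :=
    fun n => Nat.rec ⟨o, h0⟩ (fun _ v => ⟨f v.1 v.2, hf3 v.1 v.2⟩) n
  have hdist : ∀ n, Δ.dist o (c n).1 = n := by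
    intro n
    induction n with
    | zero => exact dist_self
    | succ n ih => exact (hf2 (c n).1 (c n).2).trans (by rw [ih])
  refine ⟨fun n => (c n).1, rfl, fun n => hf1 (c n).1 (c n).2, hdist, fun n => ?_⟩
  obtain ⟨a, ha⟩ := (c n).2.nonempty
  exact ⟨a, ha.1, ha.2⟩

end SimpleGraph

/-! ### Levels, ancestors and rays in a tree -/

namespace LFRootedTree

variable {V : Type*} (T : LFRootedTree V)

theorem level_finite (n : ℕ) : (T.level n).Finite := by
  induction n with
  | zero =>
    refine (Set.finite_singleton T.root).subset fun v hv => ?_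
    exact ((T.isTree.connected.dist_eq_zero_iff).1 hv).symm
  | succ n ih =>
    refine (ih.biUnion fun v _ => T.locallyFinite v).subset fun w hw => ?_
    have hw' : T.graph.dist T.root w = n + 1 := hw
    obtain ⟨v, hv, hd⟩ := T.isTree.connected.exists_adj_dist_add_one (v := w) (a := T.root) (by
      rintro rfl
      simp at hw')
    rw [SimpleGraph.dist_comm, hw', SimpleGraph.dist_comm] at hd
    exact Set.mem_biUnion (x := v) (show T.graph.dist T.root v = n by omega) hv.symm

variable {T}

theorem Below.refl (v : V) : T.Below v v := by
  simp [Below]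

theorem Below.dist_le {v w : V} (h : T.Below v w) :
    T.graph.dist T.root v ≤ T.graph.dist T.root w :=
  h ▸ Nat.le_add_right _ _

theorem Below.trans {u v w : V} (h : T.Below u v) (h' : T.Below v w) : T.Below u w := by
  unfold Below at *
  have h1 := T.isTree.connected.dist_triangle (u := u) (v := v) (w := w)
  have h2 := T.isTree.connected.dist_triangle (u := T.root) (v := u) (w := w)
  omega

theorem Below.eq_of_dist_eq {v w : V} (h : T.Below v w)
    (hd : T.graph.dist T.root v = T.graph.dist T.root w) : v = w := by
  unfold Below at h
  exact T.isTree.connected.dist_eq_zero_iff.1 (by omega)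

theorem _root_.SimpleGraph.IsTree.path_eq {W : Type*} {Δ : SimpleGraph W} (hΔ : Δ.IsTree)
    {v w : W} {p q : Δ.Walk v w} (hp : p.IsPath) (hq : q.IsPath) : p = q :=
  congrArg Subtype.val (@Subsingleton.elim _ (hΔ.isAcyclic.subsingleton_path v w) ⟨p, hp⟩ ⟨q, hq⟩)

theorem Below.getVert_eq {a w : V} (h : T.Below a w) (p : T.graph.Walk T.root w)
    (hp : p.length = T.graph.dist T.root w) : p.getVert (T.graph.dist T.root a) = a := by
  obtain ⟨q, hq⟩ := T.isTree.connected.exists_walk_length_eq_dist T.root a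
  obtain ⟨r, hr⟩ := T.isTree.connected.exists_walk_length_eq_dist a w
  have hqr : (q.append r).length = T.graph.dist T.root w := by
    rw [SimpleGraph.Walk.length_append, hq, hr]
    exact h
  have key : p = q.append r := T.isTree.path_eq (p.isPath_of_length_eq_dist hp)
    ((q.append r).isPath_of_length_eq_dist hqr)
  rw [key, SimpleGraph.Walk.getVert_append]
  simp [hq]

theorem below_getVert {w : V} (p : T.graph.Walk T.root w)
    (hp : p.length = T.graph.dist T.root w) {n : ℕ} (hn : n ≤ T.graph.dist T.root w) :
    T.graph.dist T.root (p.getVert n) = n ∧ T.Below (p.getVert n) w := by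
  have h1 := SimpleGraph.dist_le (p.take n)
  have h2 := SimpleGraph.dist_le (p.drop n)
  have h3 := T.isTree.connected.dist_triangle (u := T.root) (v := p.getVert n) (w := w)
  rw [SimpleGraph.Walk.take_length] at h1
  rw [SimpleGraph.Walk.drop_length] at h2
  unfold Below
  omega

theorem exists_below_of_le {w : V} {n : ℕ} (hn : n ≤ T.graph.dist T.root w) :
    ∃ v, T.graph.dist T.root v = n ∧ T.Below v w := by
  obtain ⟨p, hp⟩ := T.isTree.connected.exists_walk_length_eq_dist T.root w
  exact ⟨_, below_getVert p hp hn⟩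

/-- The ancestors of `w` are the vertices of the unique geodesic from the root to `w`, one per
level, hence linearly ordered. -/
theorem Below.below_of_le {a b w : V} (ha : T.Below a w) (hb : T.Below b w)
    (h : T.graph.dist T.root a ≤ T.graph.dist T.root b) : T.Below a b := by
  obtain ⟨c, hc, hcb⟩ := exists_below_of_le h
  obtain ⟨p, hp⟩ := T.isTree.connected.exists_walk_length_eq_dist T.root w
  have h1 := ha.getVert_eq p hp
  have h2 := (hcb.trans hb).getVert_eq p hp
  rw [hc, h1] at h2
  rwa [← h2] at hcb

theorem Below.eq_of_below {a b w : V} (ha : T.Below a w) (hb : T.Below b w)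
    (h : T.graph.dist T.root a = T.graph.dist T.root b) : a = b :=
  (ha.below_of_le hb h.le).eq_of_dist_eq h

namespace Boundary

theorem exists_path (ξ : T.Boundary) (n : ℕ) :
    ∃ p : T.graph.Walk (ξ.1 0) (ξ.1 n), p.IsPath ∧ p.length = n ∧
      ∀ v ∈ p.support, ∃ i ≤ n, v = ξ.1 i := by
  induction n with
  | zero => exact ⟨.nil, .nil, rfl, fun v hv => ⟨0, le_rfl, by simpa using hv⟩⟩
  | succ n ih =>
    obtain ⟨p, hp, hl, hs⟩ := ih
    refine ⟨p.concat (ξ.2.2.1 n), hp.concat (fun h => ?_) _, by simp [hl], fun v hv => ?_⟩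
    · obtain ⟨i, hi, hin⟩ := hs _ h
      have := ξ.2.2.2 hin
      omega
    · rw [SimpleGraph.Walk.support_concat] at hv
      rcases List.mem_append.1 hv with hv | hv
      · obtain ⟨i, hi, h⟩ := hs v hv
        exact ⟨i, hi.trans n.le_succ, h⟩
      · exact ⟨n + 1, le_rfl, List.mem_singleton.1 hv⟩

theorem dist_root (ξ : T.Boundary) (n : ℕ) : T.graph.dist T.root (ξ.1 n) = n := by
  obtain ⟨p, hp, hl, -⟩ := ξ.exists_path n
  obtain ⟨q, hq, hql⟩ := T.isTree.connected.exists_path_of_dist (ξ.1 0) (ξ.1 n)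
  have h0 : ξ.1 0 = T.root := ξ.2.1
  rw [T.isTree.path_eq hq hp, hl] at hql
  exact (congrArg (fun r => T.graph.dist r (ξ.1 n)) h0).symm.trans hql.symm

theorem below (ξ : T.Boundary) {m n : ℕ} (h : m ≤ n) : T.Below (ξ.1 m) (ξ.1 n) := by
  induction n, h using Nat.le_induction with
  | base => exact Below.refl _
  | succ n _ ih =>
    refine ih.trans ?_
    unfold Below
    rw [dist_root, dist_root, SimpleGraph.dist_eq_one_iff_adj.2 (ξ.2.2.1 n)]

theorem eq_of_le {ξ η : T.Boundary} {m n : ℕ} (h : m ≤ n) (e : ξ.1 n = η.1 n) :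
    ξ.1 m = η.1 m :=
  Below.eq_of_below (ξ.below h) (e ▸ η.below h) (by rw [dist_root, dist_root])

end Boundary

/-! ### Rigid stabilisers -/

variable {G : Subgroup T.Aut}

variable (G) in
/-- The elements fixing all the vertices below `v`. -/
def belowFixer (v : V) : Subgroup G where
  carrier := {g | ∀ w, T.Below v w → g • w = w}
  one_mem' := fun w _ => one_smul G w
  mul_mem' := by
    intro a b ha hb w hw
    rw [mul_smul, hb w hw, ha w hw]
  inv_mem' := by
    intro a ha w hw
    rw [inv_smul_eq_iff, ha w hw]

theorem smul_ext {g h : G} (H : ∀ w : V, g • w = h • w) : g = h :=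
  Subtype.ext (Subtype.ext (RelIso.ext H))

theorem exists_smul_ne {g : G} (hg : g ≠ 1) : ∃ w : V, g • w ≠ w := by
  by_contra! h
  exact hg (smul_ext fun w => by rw [h, one_smul])

theorem below_of_smul_ne {v w : V} {g : G} (hg : g ∈ rist G v) (h : g • w ≠ w) : T.Below v w :=
  not_not.1 fun hw => h (hg w hw)

theorem rist_anti {v w : V} (h : T.Below v w) : rist G w ≤ rist G v :=
  fun _ hg u hu => hg u fun hwu => hu (h.trans hwu)

theorem smul_eq_self_of_mem_rist {v : V} {g : G} (hg : g ∈ rist G v) : g • v = v := by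
  by_contra h
  have h1 : ¬ T.Below v (g⁻¹ • v) := fun hb => by
    have := hb.eq_of_dist_eq (dist_root_smul _ _).symm
    exact h (by conv_lhs => rw [this, smul_inv_smul])
  have := hg _ h1
  rw [smul_inv_smul] at this
  exact h (by conv_lhs => rw [this, smul_inv_smul])

theorem conj_mem_rist {v : V} {a : G} (g : G) (ha : a ∈ rist G v) :
    g * a * g⁻¹ ∈ rist G (g • v) := by
  intro w hw
  have hw' : ¬ T.Below v (g⁻¹ • w) := by rwa [← below_smul_iff g, smul_inv_smul]
  rw [mul_smul, mul_smul, ha _ hw', smul_inv_smul]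

/-- Two vertices neither of which is below the other. -/
def Incomparable (T : LFRootedTree V) (v w : V) : Prop := ¬ T.Below v w ∧ ¬ T.Below w v

theorem Incomparable.symm {v w : V} (h : T.Incomparable v w) : T.Incomparable w v := ⟨h.2, h.1⟩

theorem incomparable_of_dist_eq {v w : V}
    (h : T.graph.dist T.root v = T.graph.dist T.root w) (hvw : v ≠ w) : T.Incomparable v w :=
  ⟨fun hb => hvw (hb.eq_of_dist_eq h), fun hb => hvw (hb.eq_of_dist_eq h.symm).symm⟩

theorem Incomparable.not_below {v w u : V} (h : T.Incomparable v w) (hv : T.Below v u) :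
    ¬ T.Below w u := fun hw => by
  rcases le_total (T.graph.dist T.root v) (T.graph.dist T.root w) with hd | hd
  · exact h.1 (hv.below_of_le hw hd)
  · exact h.2 (hw.below_of_le hv hd)

theorem Incomparable.rist_le {v w : V} (h : T.Incomparable v w) :
    rist G w ≤ belowFixer G v :=
  fun _ hg u hu => hg u (h.not_below hu)

theorem commute_of_mem_belowFixer {v : V} {a c : G} (ha : a ∈ rist G v)
    (hc : c ∈ belowFixer G v) : Commute a c := by
  have hca : ∀ w, T.Below v w → T.Below v (a • w) := fun w hw => by
    have := (below_smul_iff a v w).2 hw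
    rwa [smul_eq_self_of_mem_rist ha] at this
  have hcc : ∀ w, ¬ T.Below v w → ¬ T.Below v (c • w) := fun w hw hb => by
    have := hc _ hb
    rw [smul_left_cancel_iff] at this
    exact hw (this ▸ hb)
  refine smul_ext fun w => ?_
  rw [mul_smul, mul_smul]
  by_cases hw : T.Below v w
  · rw [hc w hw, hc _ (hca w hw)]
  · rw [ha w hw, ha _ (hcc w hw)]

theorem Incomparable.commute {v w : V} (h : T.Incomparable v w) {a b : G}
    (ha : a ∈ rist G v) (hb : b ∈ rist G w) : Commute a b :=
  commute_of_mem_belowFixer ha (h.rist_le hb)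

theorem eq_one_of_mem_rist_of_mem_belowFixer {v : V} {g : G} (h : g ∈ rist G v)
    (h' : g ∈ belowFixer G v) : g = 1 :=
  smul_ext fun w => by
    rw [one_smul]
    by_cases hw : T.Below v w
    · exact h' w hw
    · exact h w hw

theorem Incomparable.eq_one {v w : V} (h : T.Incomparable v w) {g : G}
    (hv : g ∈ rist G v) (hw : g ∈ rist G w) : g = 1 :=
  eq_one_of_mem_rist_of_mem_belowFixer hv (h.rist_le hw)

theorem incomparable_smul {z : V} {g : G} (h : g • z ≠ z) : T.Incomparable (g • z) z :=
  incomparable_of_dist_eq (dist_root_smul _ _) h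

/-- The double commutator trick. -/
theorem commutator_le_of_smul_ne {J A : Subgroup G} {z : V} {g : G} (hgJ : g ∈ J)
    (hgz : g • z ≠ z) (hAz : A ≤ rist G z) (hAJ : ∀ a ∈ A, ∀ j ∈ J, a * j * a⁻¹ ∈ J) :
    ⁅A, A⁆ ≤ J := by
  have hinc := incomparable_smul hgz
  refine Subgroup.commutator_le.2 fun a ha b hb => ?_
  -- The element x = g a g⁻¹ lives under `g • z`, so it commutes with `A`. Now x a⁻¹ = g (a g⁻¹ a⁻¹)
  -- is in `J`; x cancels from its commutator with b, leaving a⁻¹ b a b⁻¹, which is conjugate by a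
  -- to [a, b]⁻¹.
  have hcomm : ∀ c ∈ A, Commute (g * a * g⁻¹) c := fun c hc =>
    hinc.commute (conj_mem_rist g (hAz ha)) (hAz hc)
  have h1 : g * a * g⁻¹ * a⁻¹ ∈ J := by
    have := J.mul_mem hgJ (hAJ a ha _ (J.inv_mem hgJ))
    simpa only [mul_assoc] using this
  have h2 : g * a * g⁻¹ * a⁻¹ * (b * (g * a * g⁻¹ * a⁻¹)⁻¹ * b⁻¹) ∈ J :=
    J.mul_mem h1 (hAJ b hb _ (J.inv_mem h1))
  have h3 : g * a * g⁻¹ * a⁻¹ * (b * (g * a * g⁻¹ * a⁻¹)⁻¹ * b⁻¹) = a⁻¹ * b * a * b⁻¹ := by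
    have hc := (((hcomm a ha).inv_right.mul_right (hcomm b hb)).mul_right (hcomm a ha)).eq
    generalize g * a * g⁻¹ = x at hc
    calc x * a⁻¹ * (b * (x * a⁻¹)⁻¹ * b⁻¹)
        = x * (a⁻¹ * b * a) * x⁻¹ * b⁻¹ := by group
      _ = a⁻¹ * b * a * b⁻¹ := by rw [hc, mul_inv_cancel_right]
  have h4 := hAJ a ha _ (h3 ▸ h2)
  have h5 : a * (a⁻¹ * b * a * b⁻¹) * a⁻¹ = (a * b * a⁻¹ * b⁻¹)⁻¹ := by
    group
  rw [h5] at h4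
  exact J.inv_mem_iff.1 h4

end LFRootedTree

/-! ### Subgroups of branch groups -/

namespace LFRootedTree

variable {V : Type*} {T : LFRootedTree V} {G : Subgroup T.Aut}

theorem map_conj_rist (g : G) (v : V) :
    (rist G v).map (MulAut.conj g).toMonoidHom = rist G (g • v) := by
  refine le_antisymm (Subgroup.map_le_iff_le_comap.2 fun a ha => conj_mem_rist g ha) fun a ha => ?_
  refine ⟨g⁻¹ * a * g, ?_, ?_⟩
  · have := conj_mem_rist g⁻¹ ha
    rwa [inv_smul_smul, inv_inv] at this
  · change g * (g⁻¹ * a * g) * g⁻¹ = a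
    group

theorem map_conj_commutator_rist (g : G) (v : V) :
    ⁅rist G v, rist G v⁆.map (MulAut.conj g).toMonoidHom = ⁅rist G (g • v), rist G (g • v)⁆ := by
  rw [Subgroup.map_commutator, map_conj_rist]

theorem conj_mem_commutator_rist {v : V} {a : G} (g : G) (ha : a ∈ ⁅rist G v, rist G v⁆) :
    g * a * g⁻¹ ∈ ⁅rist G (g • v), rist G (g • v)⁆ :=
  map_conj_commutator_rist g v ▸ Subgroup.mem_map_of_mem _ ha

theorem conj_mem_rist_iff {v : V} {a g : G} (hg : g • v = v) :
    g * a * g⁻¹ ∈ rist G v ↔ a ∈ rist G v := by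
  refine ⟨fun h => ?_, fun h => hg ▸ conj_mem_rist g h⟩
  have := conj_mem_rist g⁻¹ h
  rw [inv_smul_eq_iff.2 hg.symm] at this
  simpa [mul_assoc] using this

theorem smul_eq_self_of_mem_belowFixer {v : V} {c : G} (hc : c ∈ belowFixer G v) : c • v = v :=
  hc v (Below.refl v)

/-! ### Weakly branch groups -/

theorem exists_below_dist_eq (htr : IsLevelTransitive G) (ξ : T.Boundary) {z : V} {m : ℕ}
    (h : T.graph.dist T.root z ≤ m) : ∃ w, T.graph.dist T.root w = m ∧ T.Below z w := by
  obtain ⟨g, hg⟩ := htr _ _ (ξ.dist_root (T.graph.dist T.root z)) z rfl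
  refine ⟨g • ξ.1 m, by rw [dist_root_smul, ξ.dist_root], ?_⟩
  have := (below_smul_iff g _ _).2 (ξ.below h)
  rwa [hg] at this

theorem exists_mem_rist_ne_one (hne : ∀ z : V, ⁅rist G z, rist G z⁆ ≠ ⊥) (z : V) :
    ∃ g ∈ rist G z, g ≠ 1 := by
  by_contra! h
  have : rist G z = ⊥ := (Subgroup.eq_bot_iff_forall _).2 h
  exact hne z (by rw [this, Subgroup.commutator_bot_left])

/-- Finitely many nontrivial elements move vertices of bounded depth, while a nontrivial element of
a deeper rigid stabiliser moves only deeper vertices. -/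
theorem rist_infinite (htr : IsLevelTransitive G) (ξ : T.Boundary)
    (hne : ∀ z : V, ⁅rist G z, rist G z⁆ ≠ ⊥) (z : V) : (rist G z : Set G).Infinite := by
  intro hfin
  have hw : ∀ g : G, ∃ w : V, g ≠ 1 → g • w ≠ w := fun g => by
    by_cases hg : g = 1
    · exact ⟨z, fun h => absurd hg h⟩
    · obtain ⟨w, hw⟩ := exists_smul_ne hg
      exact ⟨w, fun _ => hw⟩
  choose w hw using hw
  obtain ⟨B, hB⟩ := (hfin.image fun g => T.graph.dist T.root (w g)).bddAbove
  obtain ⟨z', hz', hzz'⟩ := exists_below_dist_eq htr ξ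
    (le_max_left (T.graph.dist T.root z) (B + 1))
  obtain ⟨h, hh, h1⟩ := exists_mem_rist_ne_one hne z'
  have h2 := (below_of_smul_ne hh (hw h h1)).dist_le
  have h3 := hB (Set.mem_image_of_mem _ (rist_anti hzz' hh))
  have h4 := le_max_right (T.graph.dist T.root z) (B + 1)
  exact absurd (h2.trans h3) (by omega)

/-- Two uses of the double commutator trick: one inside `N ⊓ rist G z` to see that its derived
subgroup is nontrivial, one inside that derived subgroup, which `rist G z` normalises. -/
theorem exists_commutator_rist_le (htr : IsLevelTransitive G) (ξ : T.Boundary)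
    (hne : ∀ z : V, ⁅rist G z, rist G z⁆ ≠ ⊥) (N : Subgroup G) [N.Normal] [N.FiniteIndex]
    (z : V) : ∃ z', T.Below z z' ∧ ⁅rist G z', rist G z'⁆ ≤ ⁅N ⊓ rist G z, N ⊓ rist G z⁆ := by
  have hnorm : ∀ a ∈ rist G z, ∀ j ∈ N ⊓ rist G z, a * j * a⁻¹ ∈ N ⊓ rist G z :=
    fun a ha j hj => ⟨Subgroup.Normal.conj_mem ‹_› j hj.1 a,
      (rist G z).mul_mem ((rist G z).mul_mem ha hj.2) ((rist G z).inv_mem ha)⟩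
  obtain ⟨a, ha, b, hb, hab, he⟩ := (rist_infinite htr ξ hne z).exists_ne_map_eq_of_mapsTo
    (f := fun g : G => (g : G ⧸ N)) (t := Set.univ) (fun _ _ => Set.mem_univ _) Set.finite_univ
  have hD : ⁅N ⊓ rist G z, N ⊓ rist G z⁆ ≠ ⊥ := by
    have hgN : a⁻¹ * b ∈ N ⊓ rist G z :=
      ⟨QuotientGroup.eq.1 he, (rist G z).mul_mem ((rist G z).inv_mem ha) hb⟩
    obtain ⟨u, hu⟩ := exists_smul_ne (g := a⁻¹ * b) fun h => hab (inv_mul_eq_one.1 h)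
    have hzu := below_of_smul_ne hgN.2 hu
    have hle : ⁅rist G u, rist G u⁆ ≤ N ⊓ rist G z :=
      commutator_le_of_smul_ne hgN hu le_rfl fun c hc => hnorm c (rist_anti hzu hc)
    -- If the derived subgroup were trivial, a⁻¹b would commute with `⁅rist G u, rist G u⁆` while
    -- conjugating it into the rigid stabiliser of an incomparable vertex.
    intro hbot
    refine hne u ((Subgroup.eq_bot_iff_forall _).2 fun h hh => ?_)
    have hcomm : a⁻¹ * b * h = h * (a⁻¹ * b) :=
      (Subgroup.mem_centralizer_iff.1 (Subgroup.commutator_eq_bot_iff_le_centralizer.1 hbot hgN)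
        h (hle hh)).symm
    have hh' : h ∈ rist G u := Subgroup.commutator_le_self _ hh
    refine (incomparable_smul hu).eq_one ?_ hh'
    have := conj_mem_rist (a⁻¹ * b) hh'
    rwa [hcomm, mul_inv_cancel_right] at this
  obtain ⟨⟨g, hg⟩, hg1⟩ := Subgroup.ne_bot_iff_exists_ne_one.1 hD
  obtain ⟨z', hz'⟩ := exists_smul_ne (g := g) fun h => hg1 (Subtype.ext h)
  have hgz : g ∈ rist G z := (Subgroup.commutator_le_self _ hg).2
  refine ⟨z', below_of_smul_ne hgz hz', commutator_le_of_smul_ne hg hz' le_rfl ?_⟩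
  intro a ha j hj
  have ha' := rist_anti (below_of_smul_ne hgz hz') ha
  have hmap : (N ⊓ rist G z).map (MulAut.conj a).toMonoidHom ≤ N ⊓ rist G z :=
    Subgroup.map_le_iff_le_comap.2 fun j hj => hnorm a ha' j hj
  have := Subgroup.map_commutator (N ⊓ rist G z) (N ⊓ rist G z) (MulAut.conj a).toMonoidHom
  exact (this.trans_le (Subgroup.commutator_mono hmap hmap)) (Subgroup.mem_map_of_mem _ hj)

/-! ### Splitting off one rigid stabiliser -/

variable (G) in
/-- The multiplication map on the commuting subgroups `rist G v` and `belowFixer G v`. -/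
def splitHom (v : V) : rist G v × belowFixer G v →* G :=
  MonoidHom.noncommCoprod (rist G v).subtype (belowFixer G v).subtype
    fun a c => commute_of_mem_belowFixer a.2 c.2

theorem splitHom_apply (v : V) (p : rist G v × belowFixer G v) :
    splitHom G v p = p.1.1 * p.2.1 := rfl

theorem splitHom_injective (v : V) : Function.Injective (splitHom G v) := by
  refine (injective_iff_map_eq_one _).2 fun ⟨a, c⟩ h => ?_
  rw [splitHom_apply] at h
  have hc : a.1 = c.1⁻¹ := mul_eq_one_iff_eq_inv.1 h
  have ha : a.1 = 1 :=
    eq_one_of_mem_rist_of_mem_belowFixer a.2 (hc ▸ inv_mem c.2)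
  exact Prod.ext (Subtype.ext ha) (Subtype.ext (inv_eq_one.1 (hc.symm.trans ha)))

theorem splitHom_range_finiteIndex (hG : IsBranch G) {v : V}
    (hv : 1 ≤ T.graph.dist T.root v) : (splitHom G v).range.FiniteIndex := by
  have := hG.2 _ hv
  refine Subgroup.finiteIndex_of_le (H := ristLevel G (T.graph.dist T.root v)) ?_
  refine iSup₂_le fun u hu a ha => ?_
  by_cases huv : u = v
  · subst huv
    exact ⟨(⟨a, ha⟩, 1), mul_one _⟩
  · exact ⟨(1, ⟨a, (incomparable_of_dist_eq hu huv).symm.rist_le ha⟩), one_mul _⟩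

/-- The product of `rist G v` and `belowFixer G v` has finite index in `G`, so it is finitely
generated, and `rist G v` is a quotient of it. -/
theorem rist_fg (hfg : Group.FG G) (hG : IsBranch G) {v : V}
    (hv : 1 ≤ T.graph.dist T.root v) : Group.FG (rist G v) := by
  have := splitHom_range_finiteIndex hG hv
  have : Group.FG (splitHom G v).range := Subgroup.fg_of_index_ne_zero _
  let e := (MonoidHom.ofInjective (splitHom_injective (G := G) v)).symm
  exact Group.fg_of_surjective
    (f := (MonoidHom.fst (rist G v) (belowFixer G v)).comp e.toMonoidHom)
    (Prod.fst_surjective.comp e.surjective)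

/-- The projection to `rist G v` of the intersection of `K` with
`rist G v × belowFixer G v`. -/
def ristProj (v : V) (K : Subgroup G) : Subgroup (rist G v) :=
  (K.comap (splitHom G v)).map (MonoidHom.fst _ _)

theorem mem_ristProj {v : V} {K : Subgroup G} {l : rist G v} :
    l ∈ ristProj v K ↔ ∃ c ∈ belowFixer G v, l.1 * c ∈ K := by
  constructor
  · rintro ⟨p, hp, rfl⟩
    exact ⟨p.2.1, p.2.2, hp⟩
  · rintro ⟨c, hc, h⟩
    exact ⟨(l, ⟨c, hc⟩), h, rfl⟩

/-- The translates of a vertex by a normal subgroup of finite index are all the vertices of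
the same level below some vertex of the ray. -/
theorem exists_forall_below_exists_smul_eq (htr : IsLevelTransitive G) (ξ : T.Boundary)
    (N : Subgroup G) [N.Normal] [N.FiniteIndex] :
    ∃ k, ∀ n ≥ k, ∀ z, T.Below (ξ.1 n) z →
      ∃ e ∈ N, e • z = ξ.1 (T.graph.dist T.root z) := by
  -- The images in the finite group `G ⧸ N` of the decreasing stabilisers of the ray are eventually
  -- constant. Past that point, an element taking `ξ.1 m` to `z` can be corrected modulo `N` by a
  -- stabiliser of `ξ.1 m`.
  let S : ℕ → Subgroup (G ⧸ N) :=
    fun m => (MulAction.stabilizer G (ξ.1 m)).map (QuotientGroup.mk' N)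
  have hS : Antitone S := by
    intro m m' hm
    refine Subgroup.map_mono fun g hg => ?_
    have h1 := (below_smul_iff g _ _).2 (ξ.below hm)
    rw [show g • ξ.1 m' = ξ.1 m' from hg] at h1
    exact h1.eq_of_below (ξ.below hm) (dist_root_smul _ _)
  obtain ⟨k, hk⟩ := WellFoundedLT.antitone_chain_condition hS
  refine ⟨k, fun n hn z hz => ?_⟩
  set m := T.graph.dist T.root z
  have hnm : n ≤ m := by
    have := hz.dist_le
    rwa [ξ.dist_root] at this
  obtain ⟨a, ha⟩ := htr m (ξ.1 m) (ξ.dist_root m) z rfl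
  have hax : a ∈ MulAction.stabilizer G (ξ.1 n) := by
    have h1 := (below_smul_iff a _ _).2 (ξ.below hnm)
    rw [ha] at h1
    exact h1.eq_of_below hz (dist_root_smul _ _)
  have hmem : QuotientGroup.mk' N a ∈ S m := by
    rw [← hk m (hn.trans hnm), hk n hn]
    exact Subgroup.mem_map_of_mem _ hax
  obtain ⟨s, hs, hsa⟩ := hmem
  refine ⟨s * a⁻¹, ?_, ?_⟩
  · have := QuotientGroup.eq.1 hsa
    have := Subgroup.Normal.conj_mem ‹_› _ (inv_mem this) s
    convert this using 1
    group
  · rw [mul_smul, inv_smul_eq_iff.2 ha.symm]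
    exact hs

/-- Although `K` need not be finitely generated, finitely many of its elements act by conjugation on
`rist G v` like generators of a finite-index subgroup. One further nontrivial element starts the
double commutator trick. -/
theorem exists_finite_commutator_rist_le (hfg : Group.FG G) (hG : IsBranch G) (ξ : T.Boundary)
    (hne : ∀ z : V, ⁅rist G z, rist G z⁆ ≠ ⊥) {n : ℕ} (hn : 1 ≤ n) {K : Subgroup G}
    (hK : (ristProj (ξ.1 n) K).FiniteIndex) (hKne : ∀ m, K ⊓ rist G (ξ.1 m) ≠ ⊥) :
    ∃ Z : Set G, Z.Finite ∧ Z ⊆ K ∧ ∃ m, ⁅rist G (ξ.1 m), rist G (ξ.1 m)⁆ ≤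
      Subgroup.closure Z := by
  set v := ξ.1 n with hv
  have := splitHom_range_finiteIndex hG (v := v) (by rwa [hv, ξ.dist_root])
  -- Each element of `E` is an element of `K` times one that centralises `rist G v`.
  let E : Subgroup G := ((ristProj v K).comap (MonoidHom.fst _ _)).map (splitHom G v)
  have hEfin : E.FiniteIndex := by
    refine ⟨?_⟩
    rw [Subgroup.index_map_of_injective _ (splitHom_injective v),
      Subgroup.index_comap_of_surjective _ Prod.fst_surjective]
    exact mul_ne_zero hK.index_ne_zero this.index_ne_zero
  have hEk : ∀ e ∈ E, ∃ k ∈ K, k • v = v ∧ ∃ c ∈ belowFixer G v, e = k * c := by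
    rintro _ ⟨p, hp, rfl⟩
    obtain ⟨c, hc, h⟩ := mem_ristProj.1 hp
    refine ⟨_, h, ?_, c⁻¹ * p.2.1, mul_mem (inv_mem hc) p.2.2, ?_⟩
    · rw [mul_smul, smul_eq_self_of_mem_belowFixer hc]
      exact smul_eq_self_of_mem_rist p.1.2
    · rw [splitHom_apply]
      change p.1.1 * p.2.1 = p.1.1 * c * (c⁻¹ * p.2.1)
      group
  choose! k hkK hkv hkc using hEk
  obtain ⟨B, hB⟩ : E.FG := (Group.fg_iff_subgroup_fg E).1 (Subgroup.fg_of_index_ne_zero E)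
  obtain ⟨m₀, hm₀⟩ := exists_forall_below_exists_smul_eq hG.1 ξ E.normalCore
  have hnx : n ≤ max n m₀ := le_max_left _ _
  set x := ξ.1 (max n m₀)
  obtain ⟨⟨g, hgK, hgx⟩, hg1⟩ := Subgroup.ne_bot_iff_exists_ne_one.1 (hKne (max n m₀))
  obtain ⟨z, hz⟩ := exists_smul_ne (g := g) fun h => hg1 (Subtype.ext h)
  have hxz : T.Below x z := below_of_smul_ne hgx hz
  have hvx : T.Below v x := ξ.below hnx
  set F := Subgroup.closure (insert g (k '' B)) with hF
  have hEnorm : E ≤ Subgroup.normalizer (F ⊓ rist G v : Subgroup G) := by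
    rw [← hB, Subgroup.closure_le]
    intro e he
    have heE : e ∈ E := hB ▸ Subgroup.subset_closure he
    obtain ⟨c, hc, hec⟩ := hkc e heE
    rw [hec]
    refine mul_mem (Subgroup.mem_normalizer_iff.2 fun a => ?_)
      (Subgroup.mem_normalizer_iff.2 fun a => ?_)
    · have hkF : k e ∈ F := Subgroup.subset_closure (Or.inr ⟨e, he, rfl⟩)
      refine and_congr ?_ (conj_mem_rist_iff (hkv e heE)).symm
      exact ((F.mul_mem_cancel_right (inv_mem hkF)).trans (F.mul_mem_cancel_left hkF)).symm
    · by_cases ha : a ∈ rist G v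
      · rw [← (commute_of_mem_belowFixer ha hc).eq, mul_inv_cancel_right]
      · refine iff_of_false (fun h => ha h.2) fun h => ha ?_
        exact (conj_mem_rist_iff (smul_eq_self_of_mem_belowFixer hc)).1 h.2
  have hEconj : ∀ a ∈ E, ∀ j ∈ F ⊓ rist G v, a * j * a⁻¹ ∈ F ⊓ rist G v :=
    fun a ha j hj => (Subgroup.mem_normalizer_iff.1 (hEnorm ha) j).1 hj
  have hNE : E.normalCore ≤ E := E.normalCore_le
  have hle : ⁅E.normalCore ⊓ rist G z, E.normalCore ⊓ rist G z⁆ ≤ F ⊓ rist G v :=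
    commutator_le_of_smul_ne (g := g) ⟨Subgroup.subset_closure (Or.inl rfl), rist_anti hvx hgx⟩ hz
      inf_le_right fun a ha => hEconj a (hNE ha.1)
  obtain ⟨z', hzz', hz'⟩ := exists_commutator_rist_le hG.1 ξ hne E.normalCore z
  -- The vertex `z'` may be off the ray; an element of `E.normalCore` brings it back, and `E`
  -- normalises `F ⊓ rist G v`.
  obtain ⟨e, he, hez⟩ := hm₀ _ (le_max_right n m₀) z' (hxz.trans hzz')
  refine ⟨insert g (k '' B), (B.finite_toSet.image k).insert g, ?_,
    T.graph.dist T.root z', ?_⟩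
  · rintro _ (rfl | ⟨b, hb, rfl⟩)
    · exact hgK
    · exact hkK b (hB ▸ Subgroup.subset_closure hb)
  · rw [← hez, ← map_conj_commutator_rist, Subgroup.map_le_iff_le_comap]
    exact fun a ha => (hEconj e (hNE he) a (hle (hz' ha))).1

end LFRootedTree

/-! ### Displacement and Lipschitz maps to coset graphs -/

section Displacement

variable {Γ : Type*} [Group Γ]

/-- The elements of `Γ` moving every vertex of the graph of the action on `Ω` by at most `k`. -/
def displacementBall (S : Set Γ) (Ω : Type*) [MulAction Γ Ω] (k : ℕ) : Set Γ :=
  {h | ∀ c : Ω, (actionGraph S Ω).edist c (h • c) ≤ k}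

variable {S : Set Γ} {Ω : Type*} [MulAction Γ Ω]

theorem one_mem_displacementBall (k : ℕ) : (1 : Γ) ∈ displacementBall S Ω k := fun c => by
  rw [one_smul, SimpleGraph.edist_self]
  exact zero_le

theorem mul_mem_displacementBall {k l : ℕ} {a b : Γ} (ha : a ∈ displacementBall S Ω k)
    (hb : b ∈ displacementBall S Ω l) : a * b ∈ displacementBall S Ω (k + l) := fun c => by
  rw [mul_smul, Nat.cast_add, add_comm]
  exact SimpleGraph.edist_triangle.trans (add_le_add (hb c) (ha (b • c)))

theorem inv_mem_displacementBall {k : ℕ} {a : Γ} (ha : a ∈ displacementBall S Ω k) :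
    a⁻¹ ∈ displacementBall S Ω k := fun c => by
  rw [SimpleGraph.edist_comm]
  simpa using ha (a⁻¹ • c)

theorem displacementBall_mono {k l : ℕ} (h : k ≤ l) :
    displacementBall S Ω k ⊆ displacementBall S Ω l :=
  fun _ ha c => (ha c).trans (Nat.cast_le.2 h)

theorem mem_displacementBall_one {s : Γ} (hs : s ∈ S) : s ∈ displacementBall S Ω 1 := fun c => by
  by_cases h : c = s • c
  · rw [← h, SimpleGraph.edist_self]
    exact zero_le
  · have : (actionGraph S Ω).Adj c (s • c) := ⟨h, Or.inl ⟨s, hs, rfl⟩⟩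
    exact (SimpleGraph.edist_eq_one_iff_adj.2 this).le

theorem exists_mem_displacementBall (hS : Subgroup.closure S = ⊤) (h : Γ) :
    ∃ k, h ∈ displacementBall S Ω k := by
  have hh : h ∈ Subgroup.closure S := hS ▸ Subgroup.mem_top h
  induction hh using Subgroup.closure_induction with
  | mem x hx => exact ⟨1, mem_displacementBall_one hx⟩
  | one => exact ⟨0, one_mem_displacementBall 0⟩
  | mul x y _ _ hx hy =>
    obtain ⟨k, hk⟩ := hx
    obtain ⟨l, hl⟩ := hy
    exact ⟨k + l, mul_mem_displacementBall hk hl⟩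
  | inv x _ hx =>
    obtain ⟨k, hk⟩ := hx
    exact ⟨k, inv_mem_displacementBall hk⟩

theorem noncommProd_mem_displacementBall {A ι : Type*} [Group A] (ρ : A →* Γ) (s : Finset ι)
    (f : ι → A) (comm) (k : ι → ℕ) (h : ∀ i ∈ s, ρ (f i) ∈ displacementBall S Ω (k i)) :
    ρ (s.noncommProd f comm) ∈ displacementBall S Ω (∑ i ∈ s, k i) := by
  classical
  induction s using Finset.induction_on with
  | empty =>
    rw [Finset.noncommProd_empty, map_one]
    exact one_mem_displacementBall _
  | insert a s ha ih =>
    rw [Finset.noncommProd_insert_of_notMem _ _ _ _ ha, map_mul, Finset.sum_insert ha]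
    exact mul_mem_displacementBall (h a (Finset.mem_insert_self a s))
      (ih _ fun i hi => h i (Finset.mem_insert_of_mem hi))

theorem actionGraph_connected [Nonempty Ω] [MulAction.IsPretransitive Γ Ω]
    (hS : Subgroup.closure S = ⊤) : (actionGraph S Ω).Connected := by
  refine ⟨fun a b => ?_⟩
  obtain ⟨g, rfl⟩ := MulAction.exists_smul_eq Γ a b
  obtain ⟨k, hk⟩ := exists_mem_displacementBall (Ω := Ω) hS g
  exact SimpleGraph.reachable_of_edist_ne_top
    ((hk a).trans_lt (ENat.natCast_lt_top k)).ne

end Displacement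

/-- A finitely generated group contains a ray whose images are distinct in a given infinite
coset space. -/
theorem exists_ray_of_not_finiteIndex {L : Type*} [Group L] (hL : Group.FG L) {K : Subgroup L}
    (hK : ¬ K.FiniteIndex) :
    ∃ B : Set L, B.Finite ∧ ∃ g : ℕ → L, (∀ n, ∃ s ∈ B, g (n + 1) = s * g n) ∧
      ∀ m n, (g m)⁻¹ * g n ∈ K → m = n := by
  obtain ⟨S, hS⟩ := hL.out
  have hinf : Infinite (L ⧸ K) := not_finite_iff_infinite.1 fun h => hK
    Subgroup.finiteIndex_of_finite_quotient
  have hfin : ∀ v, ((actionGraph (S : Set L) (L ⧸ K)).neighborSet v).Finite := fun v => by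
    refine ((S.finite_toSet.image fun s => s • v).union
      (S.finite_toSet.image fun s => s⁻¹ • v)).subset ?_
    rintro w ⟨-, ⟨s, hs, h⟩ | ⟨s, hs, h⟩⟩
    · exact Or.inl ⟨s, hs, h⟩
    · exact Or.inr ⟨s, hs, inv_smul_eq_iff.2 h.symm⟩
  obtain ⟨c, h0, hadj, hdist, -⟩ := (actionGraph_connected hS).exists_geodesic_ray hfin
    (QuotientGroup.mk (s := K) 1) Set.infinite_univ
  -- Edges are unoriented, so inverses of generators are needed. The geodesic lifts to `L` from 1,
  -- and its vertices are distinct because their distances to the origin are.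
  have hstep : ∀ n, ∃ s ∈ (S : Set L) ∪ (S : Set L)⁻¹, s • c n = c (n + 1) := fun n => by
    rcases (hadj n).2 with ⟨s, hs, h⟩ | ⟨s, hs, h⟩
    · exact ⟨s, Or.inl hs, h⟩
    · exact ⟨s⁻¹, Or.inr (by simpa using hs), inv_smul_eq_iff.2 h.symm⟩
  choose s hs hsc using hstep
  let g : ℕ → L := fun n => Nat.rec 1 (fun n a => s n * a) n
  have hg : ∀ n, QuotientGroup.mk (s := K) (g n) = c n := by
    intro n
    induction n with
    | zero => exact h0.symm
    | succ n ih =>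
      rw [← hsc n, ← ih]
      rfl
  refine ⟨_, S.finite_toSet.union S.finite_toSet.inv, g, fun n => ⟨s n, hs n, rfl⟩,
    fun m n h => ?_⟩
  rw [← hdist m, ← hdist n, ← hg, ← hg, QuotientGroup.eq.2 h]

/-- Commuting finitely generated subgroups of infinite index in the coset space of `P` produce a
Lipschitz embedding of `ℕ ^ k`. -/
theorem le_leud_of_commuting {Γ A : Type*} [Group Γ] [Group A] {S : Set Γ}
    (hS : Subgroup.closure S = ⊤) (P : Subgroup Γ) (ρ : A →* Γ) {k : ℕ} {L : Fin k → Subgroup A}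
    (hL : ∀ i, Group.FG (L i))
    (hcomm : Pairwise fun i j => ∀ x y : A, x ∈ L i → y ∈ L j → Commute x y)
    (K : ∀ i, Subgroup (L i)) (hK : ∀ i, ¬ (K i).FiniteIndex)
    (hP : ∀ l : ∀ i, L i, ρ (Subgroup.noncommPiCoprod hcomm l) ∈ P → ∀ i, l i ∈ K i) :
    (k : ℕ∞) ≤ leud (actionGraph S (Γ ⧸ P)) := by
  choose B hB g hgB hgK using fun i => exists_ray_of_not_finiteIndex (hL i) (hK i)
  choose s hs hgs using hgB
  set D := displacementBall S (Γ ⧸ P)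
  obtain ⟨C, hC⟩ : ∃ C, ∀ i, ∀ b ∈ B i, ρ b ∈ D C := by
    choose b hb using fun h : Γ => exists_mem_displacementBall (Ω := Γ ⧸ P) hS h
    choose C hC using fun i => ((hB i).image fun l : L i => b (ρ l)).bddAbove
    refine ⟨∑ i, C i, fun i l hl => displacementBall_mono ?_ (hb (ρ l))⟩
    exact (hC i (Set.mem_image_of_mem _ hl)).trans
      (Finset.single_le_sum (f := C) (fun _ _ => Nat.zero_le _) (Finset.mem_univ i))
  -- This element is a product of `b` elements of `B i`, and displacement is bounded uniformly over
  -- all cosets.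
  have hadd : ∀ i a b, ρ (g i (a + b) * (g i a)⁻¹ : L i) ∈ D (C * b) := by
    intro i a b
    induction b with
    | zero => simpa using one_mem_displacementBall _
    | succ b ih =>
      have h1 := mul_mem_displacementBall (hC i _ (hs i (a + b))) ih
      rw [← map_mul] at h1
      rw [Nat.mul_succ, add_comm (C * b), ← add_assoc, hgs, mul_assoc, Subgroup.coe_mul]
      exact h1
  have hdist : ∀ i a b, ρ (g i b * (g i a)⁻¹ : L i) ∈ D (C * Nat.dist a b) := by
    intro i a b
    rcases le_total a b with h | h
    · obtain ⟨c, rfl⟩ := Nat.exists_eq_add_of_le h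
      rw [Nat.dist_eq_sub_of_le h, Nat.add_sub_cancel_left]
      exact hadd i a c
    · obtain ⟨c, rfl⟩ := Nat.exists_eq_add_of_le h
      rw [Nat.dist_eq_sub_of_le_right h, Nat.add_sub_cancel_left]
      convert inv_mem_displacementBall (hadd i b c) using 1
      rw [← map_inv]
      simp
  let f : (Fin k → ℕ) → Γ ⧸ P :=
    fun n => (ρ (Subgroup.noncommPiCoprod hcomm fun i => g i (n i)) : Γ)
  have hinj : Function.Injective f := by
    intro m n h
    have h1 := QuotientGroup.eq.1 h
    rw [← map_inv, ← map_mul, ← map_inv, ← map_mul] at h1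
    exact funext fun i => hgK i _ _ (hP _ h1 i)
  refine le_iSup₂_of_le k ⟨f, ⟨C, fun m n => ?_⟩, 1, fun v => ?_⟩ le_rfl
  · have h1 : f n = ρ (Subgroup.noncommPiCoprod hcomm fun i => g i (n i) * (g i (m i))⁻¹) • f m := by
      change _ = ((_ * _ : Γ) : Γ ⧸ P)
      rw [← map_mul, ← map_mul]
      have : (fun i => g i (n i)) = (fun i => g i (n i) * (g i (m i))⁻¹) * fun i => g i (m i) :=
        funext fun i => (inv_mul_cancel_right _ _).symm
      rw [← this]
    rw [h1]
    have h2 := noncommProd_mem_displacementBall (S := S) (Ω := Γ ⧸ P) ρ Finset.univ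
      (fun i => ((g i (n i) * (g i (m i))⁻¹ : L i) : A))
      (fun i _ j _ hij => hcomm hij _ _ (SetLike.coe_mem _) (SetLike.coe_mem _)) _
      fun i _ => hdist i (m i) (n i)
    rw [← Finset.mul_sum] at h2
    rw [Subgroup.noncommPiCoprod_apply]
    exact h2 _
  · exact (Set.encard_le_one_iff_subsingleton.2 fun a ha b hb => hinj (ha.trans hb.symm)).trans
      (by simp)

/-! ### Germs and supports -/

section ClosedSupport

variable {Γ X : Type*} [Group Γ] [TopologicalSpace X] (φ : Γ →* (X ≃ₜ X))

theorem notMem_closedSupport_iff {J : Subgroup Γ} {y : X} :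
    y ∉ closedSupport φ J ↔ ∀ᶠ x in 𝓝 y, ∀ k ∈ J, φ k x = x := by
  rw [closedSupport, mem_closure_iff_frequently, Filter.not_frequently]
  simp only [Set.mem_compl_iff, not_not, Set.mem_ofPred_eq]

theorem closedSupport_mono {J J' : Subgroup Γ} (h : J ≤ J') :
    closedSupport φ J ⊆ closedSupport φ J' :=
  closure_mono (Set.compl_subset_compl.2 fun _ hx k hk => hx k (h hk))

theorem forall_mem_closure_apply_eq {Z : Set Γ} {x : X} (h : ∀ k ∈ Z, φ k x = x) :
    ∀ k ∈ Subgroup.closure Z, φ k x = x := by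
  intro k hk
  induction hk using Subgroup.closure_induction with
  | mem k hk => exact h k hk
  | one => rw [map_one]; rfl
  | mul a b _ _ ha hb =>
    rw [map_mul]
    change φ a (φ b x) = x
    rw [hb, ha]
  | inv a _ ha =>
    rw [map_inv]
    exact (φ a).toEquiv.symm_apply_eq.2 ha.symm

/-- A finitely generated subgroup of the germ-stabiliser fixes a neighbourhood. -/
theorem notMem_closedSupport_closure {Z : Set Γ} (hZ : Z.Finite) {y : X}
    (h : Z ⊆ germStabilizer φ y) : y ∉ closedSupport φ (Subgroup.closure Z) :=
  (notMem_closedSupport_iff φ).2 <|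
    ((Filter.eventually_all_finite hZ).2 fun _ hk => h hk).mono fun _ hx =>
      forall_mem_closure_apply_eq φ hx

theorem closedSupport_bot : closedSupport φ ⊥ = ∅ := by
  refine Set.eq_empty_of_forall_notMem fun y => (notMem_closedSupport_iff φ).2 ?_
  refine Filter.Eventually.of_forall fun x k hk => ?_
  rw [Subgroup.mem_bot.1 hk, map_one]
  rfl

theorem apply_mem_closedSupport_map (g : Γ) {J : Subgroup Γ} {y : X}
    (hy : y ∈ closedSupport φ J) :
    φ g y ∈ closedSupport φ (J.map (MulAut.conj g).toMonoidHom) := by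
  refine map_mem_closure (φ g).continuous hy fun x hx h => hx fun k hk => (φ g).injective ?_
  have h1 := h _ (Subgroup.mem_map_of_mem _ hk)
  have h2 : φ (g * k * g⁻¹) (φ g x) = φ g (φ k x) := by
    change (φ (g * k * g⁻¹) * φ g) x = (φ g * φ k) x
    rw [← map_mul, ← map_mul, inv_mul_cancel_right]
  exact h2.symm.trans h1

end ClosedSupport

/-! ### Rays in the support and the graph of germs -/

namespace LFRootedTree

variable {V : Type*} {T : LFRootedTree V} {G : Subgroup T.Aut}

/-- Modulo the right-hand side, each `rist G v` becomes abelian and distinct ones commute, so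
`ristLevel G n` becomes abelian. -/
theorem commutator_ristLevel_le (n : ℕ) :
    ⁅ristLevel G n, ristLevel G n⁆ ≤ ⨆ v ∈ T.level n, ⁅rist G v, rist G v⁆ := by
  set D := ⨆ v ∈ T.level n, ⁅rist G v, rist G v⁆ with hD
  have hle : ∀ v ∈ T.level n, ⁅rist G v, rist G v⁆ ≤ D := fun v hv =>
    le_iSup₂ (f := fun v (_ : v ∈ T.level n) => ⁅rist G v, rist G v⁆) v hv
  have : D.Normal := ⟨fun k hk g => by
    suffices h : D ≤ D.comap (MulAut.conj g).toMonoidHom from h hk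
    exact iSup₂_le fun v hv a ha => hle (g • v) ((dist_root_smul g v).trans hv)
      (conj_mem_commutator_rist g ha)⟩
  have key : ⁅(ristLevel G n).map (QuotientGroup.mk' D),
      (ristLevel G n).map (QuotientGroup.mk' D)⁆ = ⊥ := by
    rw [Subgroup.commutator_eq_bot_iff_le_centralizer, Subgroup.map_le_iff_le_comap]
    refine iSup₂_le fun v hv => ?_
    rw [← Subgroup.map_le_iff_le_comap, Subgroup.le_centralizer_iff, Subgroup.map_le_iff_le_comap]
    refine iSup₂_le fun w hw => ?_
    rw [← Subgroup.map_le_iff_le_comap, ← Subgroup.commutator_eq_bot_iff_le_centralizer,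
      ← Subgroup.map_commutator, Subgroup.map_eq_bot_iff, QuotientGroup.ker_mk']
    by_cases hvw : w = v
    · rw [hvw]
      exact hle v hv
    · refine le_of_eq_of_le ?_ bot_le
      rw [Subgroup.commutator_eq_bot_iff_le_centralizer]
      exact fun a ha => Subgroup.mem_centralizer_iff.2 fun b hb =>
        ((incomparable_of_dist_eq (hw.trans hv.symm) hvw).commute ha hb).eq.symm
  rwa [← Subgroup.map_commutator, Subgroup.map_eq_bot_iff, QuotientGroup.ker_mk'] at key

theorem exists_mem_closedSupport_rist {X : Type*} [TopologicalSpace X] (φ : G →* (X ≃ₜ X)) {n : ℕ}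
    {y : X} (hy : y ∈ closedSupport φ ⁅ristLevel G n, ristLevel G n⁆) :
    ∃ v ∈ T.level n, y ∈ closedSupport φ ⁅rist G v, rist G v⁆ := by
  by_contra! h
  simp only [notMem_closedSupport_iff] at h
  refine (notMem_closedSupport_iff φ).2 ?_ hy
  filter_upwards [(Filter.eventually_all_finite (T.level_finite n)).2 h] with x hx k hk
  have hsup : (⨆ v ∈ T.level n, ⁅rist G v, rist G v⁆) ≤
      Subgroup.closure {k : G | φ k x = x} :=
    iSup₂_le fun v hv k hk => Subgroup.subset_closure (hx v hv k hk)
  exact forall_mem_closure_apply_eq φ (fun k hk => hk) k (hsup (commutator_ristLevel_le n hk))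

/-! ### Bounding the number of rays -/

theorem exists_incomparable (hne : ∀ z : V, ⁅rist G z, rist G z⁆ ≠ ⊥) (ξ : T.Boundary) (k : ℕ) :
    ∀ n, ∃ u : Fin k → V, Pairwise (fun i j => T.Incomparable (u i) (u j)) ∧
      ∀ i, T.Below (ξ.1 n) (u i) ∧ n < T.graph.dist T.root (u i) := by
  induction k with
  | zero => exact fun n => ⟨Fin.elim0, fun i => i.elim0, fun i => i.elim0⟩
  | succ k ih =>
    intro n
    -- If `g` moves `z`, then `z` or `g • z` is off the ray. The remaining vertices are sought below
    -- the ray at the level of `z`, hence incomparable with it.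
    obtain ⟨z, hz, hzn, hzξ⟩ : ∃ z, T.Below (ξ.1 n) z ∧ n < T.graph.dist T.root z ∧
        z ≠ ξ.1 (T.graph.dist T.root z) := by
      obtain ⟨g, hg, hg1⟩ := exists_mem_rist_ne_one hne (ξ.1 n)
      obtain ⟨z, hz⟩ := exists_smul_ne hg1
      have hb := below_of_smul_ne hg hz
      have hgξ := smul_eq_self_of_mem_rist hg
      have hlt : n < T.graph.dist T.root z := by
        refine lt_of_le_of_ne ((ξ.dist_root n).symm.trans_le hb.dist_le) fun h => hz ?_
        rwa [hb.eq_of_dist_eq ((ξ.dist_root n).trans h)] at hgξ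
      by_cases hzξ : z = ξ.1 (T.graph.dist T.root z)
      · refine ⟨g • z, ?_, by rwa [dist_root_smul], ?_⟩
        · have := (below_smul_iff g _ _).2 hb
          rwa [hgξ] at this
        · rw [dist_root_smul, ← hzξ]
          exact hz
      · exact ⟨z, hb, hlt, hzξ⟩
    set m := T.graph.dist T.root z
    obtain ⟨u, hu, hun⟩ := ih m
    have hinc : ∀ i, T.Incomparable z (u i) := fun i =>
      ⟨(incomparable_of_dist_eq (ξ.dist_root m) hzξ.symm).not_below (hun i).1,
        fun h => absurd h.dist_le (hun i).2.not_ge⟩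
    refine ⟨Fin.cons z u, ?_, ?_⟩
    · intro i j hij
      induction i using Fin.cases with
      | zero =>
        induction j using Fin.cases with
        | zero => exact absurd rfl hij
        | succ j => exact hinc j
      | succ i =>
        induction j using Fin.cases with
        | zero => exact (hinc i).symm
        | succ j => exact hu fun h => hij (congrArg Fin.succ h)
    · intro i
      induction i using Fin.cases with
      | zero => exact ⟨hz, hzn⟩
      | succ i => exact ⟨(ξ.below hzn.le).trans (hun i).1, hzn.trans (hun i).2⟩

theorem _root_.Subgroup.noncommPiCoprod_mem {A ι : Type*} [Group A] [Fintype ι]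
    {L : ι → Subgroup A} {M : Subgroup A}
    (hcomm : Pairwise fun i j => ∀ x y : A, x ∈ L i → y ∈ L j → Commute x y)
    (hM : ∀ i, L i ≤ M) (l : ∀ i, L i) : Subgroup.noncommPiCoprod hcomm l ∈ M := by
  rw [Subgroup.noncommPiCoprod_apply]
  exact Subgroup.noncommProd_mem _ _ fun i _ => hM i (l i).2

theorem exists_noncommPiCoprod_eq {k : ℕ} {v : Fin k → V}
    (hv : Pairwise fun i j => T.Incomparable (v i) (v j))
    (hcomm : Pairwise fun i j => ∀ x y : G, x ∈ rist G (v i) → y ∈ rist G (v j) → Commute x y)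
    (l : ∀ i, rist G (v i)) (i : Fin k) :
    ∃ c ∈ belowFixer G (v i), Subgroup.noncommPiCoprod hcomm l = l i * c := by
  refine ⟨Subgroup.noncommPiCoprod hcomm (Pi.mulSingle i (l i)⁻¹ * l), ?_, ?_⟩
  · rw [Subgroup.noncommPiCoprod_apply]
    refine Subgroup.noncommProd_mem _ _ fun j _ => ?_
    by_cases hj : j = i
    · subst hj
      simp [one_mem]
    · simp only [Pi.mul_apply, Pi.mulSingle_eq_of_ne hj, one_mul]
      exact (hv (Ne.symm hj)).rist_le (l j).2
  · rw [map_mul, Subgroup.noncommPiCoprod_mulSingle]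
    simp

theorem commutator_rist_ne_bot_of_mem_closedSupport {X : Type*} [TopologicalSpace X]
    (htr : IsLevelTransitive G) (φ : G →* (X ≃ₜ X)) {ξ : T.Boundary} {y : X}
    (hy : ∀ n, y ∈ closedSupport φ ⁅rist G (ξ.1 n), rist G (ξ.1 n)⁆) (z : V) :
    ⁅rist G z, rist G z⁆ ≠ ⊥ := by
  intro h
  obtain ⟨g, hg⟩ := htr _ z rfl _ (ξ.dist_root (T.graph.dist T.root z))
  have := hy (T.graph.dist T.root z)
  rw [← hg, ← map_conj_commutator_rist, h, Subgroup.map_bot, closedSupport_bot] at this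
  exact this

theorem Boundary.exists_forall_ne {k : ℕ} {η : Fin k → T.Boundary} (hη : Function.Injective η) :
    ∃ n, 1 ≤ n ∧ ∀ i j, i ≠ j → (η i).1 n ≠ (η j).1 n := by
  have : ∀ i j, ∃ n, i ≠ j → (η i).1 n ≠ (η j).1 n := fun i j => by
    by_contra! h
    exact (h 0).1 (hη (Subtype.ext (funext fun n => (h n).2)))
  choose n hn using this
  -- Rays separated at one level stay separated later; the final 1 makes the level positive, as the
  -- branch condition requires.
  refine ⟨∑ i, ∑ j, n i j + 1, Nat.le_add_left _ _, fun i j hij h => hn i j hij ?_⟩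
  refine eq_of_le ?_ h
  have h1 := Finset.single_le_sum (f := fun j => n i j) (fun _ _ => Nat.zero_le _)
    (Finset.mem_univ j)
  have h2 := Finset.single_le_sum (f := fun i => ∑ j, n i j) (fun _ _ => Nat.zero_le _)
    (Finset.mem_univ i)
  exact (h1.trans h2).trans (Nat.le_succ _)

theorem le_leud_graphOfGerms {X : Type*} [TopologicalSpace X] (hfg : Group.FG G)
    (hG : IsBranch G) (H : Subgroup (X ≃ₜ X)) {S : Set H} (hS : Subgroup.closure S = ⊤)
    (ρ : G →* H) {y : X} {k : ℕ} {η : Fin k → T.Boundary} (hη : Function.Injective η)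
    (hy : ∀ i n, y ∈ closedSupport (H.subtype.comp ρ) ⁅rist G ((η i).1 n), rist G ((η i).1 n)⁆) :
    (k : ℕ∞) ≤ leud (graphOfGerms H.subtype S y) := by
  obtain ⟨n, hn, hneq⟩ := Boundary.exists_forall_ne hη
  set K : Subgroup G := germStabilizer (H.subtype.comp ρ) y
  by_cases hcase : ∀ i, ¬ (ristProj ((η i).1 n) K).FiniteIndex
  · have hinc : Pairwise fun i j => T.Incomparable ((η i).1 n) ((η j).1 n) := fun i j hij =>
      incomparable_of_dist_eq (by rw [Boundary.dist_root, Boundary.dist_root]) (hneq i j hij)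
    refine le_leud_of_commuting hS _ ρ (L := fun i => rist G ((η i).1 n))
      (fun i => rist_fg hfg hG (by rwa [Boundary.dist_root]))
      (fun i j hij _ _ ha hb => (hinc hij).commute ha hb) _ hcase fun l hl i => ?_
    obtain ⟨c, hc, hlc⟩ := exists_noncommPiCoprod_eq hinc
      (fun i j hij _ _ ha hb => (hinc hij).commute ha hb) l i
    exact mem_ristProj.2 ⟨c, hc, hlc ▸ hl⟩
  · push Not at hcase
    obtain ⟨i, hi⟩ := hcase
    have hne := commutator_rist_ne_bot_of_mem_closedSupport hG.1 _ (hy i)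
    by_cases hKne : ∀ m, K ⊓ rist G ((η i).1 m) ≠ ⊥
    · obtain ⟨Z, hZ, hZK, m, hm⟩ :=
        exists_finite_commutator_rist_le hfg hG (η i) hne hn hi hKne
      -- The finite set `Z` of trivial germs fixes a common neighbourhood of `y`, contradicting `hy
      -- i m`.
      exact absurd (closedSupport_mono _ hm (hy i m)) (notMem_closedSupport_closure _ hZ hZK)
    · push Not at hKne
      obtain ⟨m, hm⟩ := hKne
      obtain ⟨u, hu, hum⟩ := exists_incomparable hne (η i) k m
      -- Here the product of the groups `rist G (u i)` meets `K` trivially, so the trivial subgroups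
      -- serve as the `K i`.
      refine le_leud_of_commuting hS _ ρ (L := fun i => rist G (u i))
        (fun i => rist_fg hfg hG (Nat.one_le_of_lt (hum i).2))
        (fun i j hij _ _ ha hb => (hu hij).commute ha hb) (fun _ => ⊥) (fun j hj => ?_)
        fun l hl j => ?_
      · have : Infinite (rist G (u j)) := (rist_infinite hG.1 (η i) hne (u j)).to_subtype
        exact hj.index_ne_zero (by rw [Subgroup.index_bot, Nat.card_eq_zero_of_infinite])
      · obtain ⟨c, hc, hlc⟩ := exists_noncommPiCoprod_eq hu
          (fun i j hij _ _ ha hb => (hu hij).commute ha hb) l j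
        have h1 : Subgroup.noncommPiCoprod
            (fun i j hij _ _ ha hb => (hu hij).commute ha hb) l ∈ K ⊓ rist G ((η i).1 m) :=
          ⟨hl, Subgroup.noncommPiCoprod_mem _ (fun j => rist_anti (hum j).1) l⟩
        rw [hm, Subgroup.mem_bot, hlc] at h1
        refine Subgroup.mem_bot.2 (Subtype.ext ?_)
        refine eq_one_of_mem_rist_of_mem_belowFixer (l j).2 ?_
        rw [mul_eq_one_iff_eq_inv.1 h1]
        exact inv_mem hc

/-! ### The boundary -/

theorem Boundary.continuous_val : letI : TopologicalSpace V := ⊥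
    Continuous (fun ξ : T.Boundary => ξ.1) :=
  continuous_induced_dom

theorem Boundary.isClopen_cylinder (n : ℕ) (A : Set V) :
    IsClopen {ξ : T.Boundary | ξ.1 n ∈ A} := by
  let _ : TopologicalSpace V := ⊥
  have : DiscreteTopology V := ⟨rfl⟩
  exact (isClopen_discrete A).preimage ((continuous_apply n).comp Boundary.continuous_val)

instance : T2Space T.Boundary := by
  let _ : TopologicalSpace V := ⊥
  have : DiscreteTopology V := ⟨rfl⟩
  exact T2Space.of_injective_continuous Subtype.val_injective Boundary.continuous_val

instance : CompactSpace T.Boundary := by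
  let _ : TopologicalSpace V := ⊥
  have : DiscreteTopology V := ⟨rfl⟩
  have hind : IsInducing (Subtype.val : T.Boundary → ℕ → V) := ⟨rfl⟩
  have hcl : IsClosed {ξ : ℕ → V |
      ξ 0 = T.root ∧ (∀ n, T.graph.Adj (ξ n) (ξ (n + 1))) ∧ Function.Injective ξ} := by
    have hd : ∀ (m n : ℕ) (p : V → V → Prop), IsClosed {ξ : ℕ → V | p (ξ m) (ξ n)} :=
      fun m n p => IsClosed.preimage (f := fun ξ : ℕ → V => (ξ m, ξ n)) (t := {q : V × V | p q.1 q.2})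
        ((continuous_apply m).prodMk (continuous_apply n)) (isClosed_discrete _)
    have h1 : IsClosed {ξ : ℕ → V | ξ 0 = T.root} := hd 0 0 fun a _ => a = T.root
    have h2 : IsClosed {ξ : ℕ → V | ∀ n, T.graph.Adj (ξ n) (ξ (n + 1))} := by
      simp only [Set.ofPred_forall]
      exact isClosed_iInter fun n => hd n (n + 1) T.graph.Adj
    have h3 : IsClosed {ξ : ℕ → V | Function.Injective ξ} := by
      simp only [Function.Injective, Set.ofPred_forall]
      exact isClosed_iInter fun m => isClosed_iInter fun n => hd m n fun a b => a = b → m = n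
    exact h1.inter (h2.inter h3)
  refine ⟨hind.isCompact_iff.2 ?_⟩
  have hK : IsCompact (Set.univ.pi fun n => T.level n) :=
    isCompact_univ_pi fun n => (T.level_finite n).isCompact
  refine hK.of_isClosed_subset ?_ ?_
  · convert hcl using 1
    exact (Set.image_univ (f := (Subtype.val : T.Boundary → ℕ → V))).trans Subtype.range_coe
  · rintro _ ⟨ξ, -, rfl⟩ n -
    exact Boundary.dist_root (T := T) ξ n

/-! ### The configuration attached to a point -/

variable {X : Type*} [TopologicalSpace X] (φ : G →* (X ≃ₜ X))

/-- The rays all of whose rigid stabilisers have derived subgroups supported at `y`. -/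
def supportRays (y : X) : Set T.Boundary :=
  {ξ | ∀ n, y ∈ closedSupport φ ⁅rist G (ξ.1 n), rist G (ξ.1 n)⁆}

/-- The vertices whose derived rigid stabiliser is supported at `y` occur at every positive level
and are closed under passing to ancestors, so Kőnig's lemma applies. -/
theorem supportRays_nonempty {y : X} (hy : y ∈ essentialSupport G φ) :
    (supportRays φ y).Nonempty := by
  simp only [essentialSupport, Set.mem_iInter] at hy
  have hA : {w : V | y ∈ closedSupport φ ⁅rist G w, rist G w⁆}.Infinite := by
    intro hfin
    obtain ⟨B, hB⟩ := (hfin.image fun w => T.graph.dist T.root w).bddAbove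
    obtain ⟨v, hv, hyv⟩ := exists_mem_closedSupport_rist φ (hy (B + 1) (Nat.le_add_left _ _))
    have := hB (Set.mem_image_of_mem _ hyv)
    have hv' : T.graph.dist T.root v = B + 1 := hv
    exact absurd (hv'.symm.trans_le this) (by omega)
  obtain ⟨c, h0, hadj, hdist, hc⟩ :=
    T.isTree.connected.exists_geodesic_ray T.locallyFinite T.root hA
  refine ⟨⟨c, h0, hadj, fun m n h => ?_⟩, fun n => ?_⟩
  · rw [← hdist m, ← hdist n, h]
  · obtain ⟨a, ha, hb⟩ := hc n
    exact closedSupport_mono φ (Subgroup.commutator_mono (rist_anti hb) (rist_anti hb)) ha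

theorem isClosed_supportRays :
    IsClosed {p : X × T.Boundary | p.2 ∈ supportRays φ p.1} := by
  have hn : ∀ n, IsClosed {p : X × T.Boundary |
      p.1 ∈ closedSupport φ ⁅rist G (p.2.1 n), rist G (p.2.1 n)⁆} := fun n => by
    have : {p : X × T.Boundary |
          p.1 ∈ closedSupport φ ⁅rist G (p.2.1 n), rist G (p.2.1 n)⁆}ᶜ =
        ⋃ v : V, (closedSupport φ ⁅rist G v, rist G v⁆)ᶜ ×ˢ
          {ξ : T.Boundary | ξ.1 n ∈ ({v} : Set V)} := by
      ext p
      simp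
    refine ⟨?_⟩
    rw [this]
    exact isOpen_iUnion fun v => isClosed_closure.isOpen_compl.prod
      (Boundary.isClopen_cylinder n {v}).isOpen
  convert isClosed_iInter hn using 1
  ext p
  simp [supportRays]

theorem smul_mem_supportRays (g : G) {y : X} {ξ : T.Boundary} (h : ξ ∈ supportRays φ y) :
    g • ξ ∈ supportRays φ (φ g y) := fun n => by
  have := apply_mem_closedSupport_map φ g (h n)
  rwa [map_conj_commutator_rist] at this

theorem supportRays_apply (g : G) (y : X) :
    supportRays φ (φ g y) = (fun ξ => g • ξ) '' supportRays φ y := by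
  refine Set.Subset.antisymm (fun ξ hξ => ⟨g⁻¹ • ξ, ?_, smul_inv_smul g ξ⟩) ?_
  · have := smul_mem_supportRays φ g⁻¹ hξ
    rwa [map_inv, show (φ g)⁻¹ (φ g y) = y from (φ g).symm_apply_apply y] at this
  · rintro _ ⟨ξ, hξ, rfl⟩
    exact smul_mem_supportRays φ g hξ

end LFRootedTree

/-! ### Semi-continuity and the main theorem -/

theorem Config.isUpperSemicontinuous_of_isClosed {Y Z : Type*} [TopologicalSpace Y]
    [TopologicalSpace Z] {d : ℕ} {q : Y → Config Z d}
    (h : IsClosed {p : Y × Z | p.2 ∈ (q p.1).1}) : Config.IsUpperSemicontinuous q := by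
  intro K hK
  have : CompactSpace K := isCompact_iff_compactSpace.1 hK
  have h1 : IsClosed {p : Y × K | p.2.1 ∈ (q p.1).1} :=
    h.preimage (continuous_fst.prodMk (continuous_subtype_val.comp continuous_snd))
  -- Projection along the compact factor `K` is closed; its image is the set of points whose value
  -- meets `K`.
  have h2 := (isClosedMap_fst_of_compactSpace _ h1).isOpen_compl
  convert h2 using 1
  ext y
  simp only [Set.mem_ofPred_eq, Set.mem_compl_iff, Set.mem_image, Prod.exists, exists_and_right,
    exists_eq_right, not_exists, Set.eq_empty_iff_forall_notMem, Set.mem_inter_iff, Subtype.forall]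
  exact ⟨fun H a ha hq => H a ⟨hq, ha⟩, fun H a ha => H a ha.2 ha.1⟩

theorem Config.IsUpperSemicontinuous.continuous_of_one {Y Z : Type*} [TopologicalSpace Y]
    [TopologicalSpace Z] [CompactSpace Z] [T2Space Z] {d : ℕ} (hd : d = 1) {q : Y → Config Z d}
    (hq : Config.IsUpperSemicontinuous q) :
    Continuous q ∧ ∃ f : Y → Z, Continuous f ∧ ∀ y, (q y).1 = {f y} := by
  have hsing : ∀ y, ∃ z, (q y).1 = {z} := fun y =>
    Set.encard_eq_one.1 (le_antisymm ((q y).2.2.trans (by rw [hd]; rfl))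
      (Set.one_le_encard_iff_nonempty.2 (q y).2.1))
  choose f hf using hsing
  have hcont : Continuous f := by
    refine continuous_def.2 fun U hU => ?_
    -- A singleton lies in `U` exactly when it misses the compact set `Uᶜ`.
    convert hq Uᶜ hU.isClosed_compl.isCompact using 1
    ext y
    simp [hf]
  refine ⟨continuous_generateFrom_iff.2 ?_, f, hcont, hf⟩
  rintro _ (⟨K, hK, rfl⟩ | ⟨U, hU, rfl⟩)
  · exact hq K hK
  · convert hU.preimage hcont using 1
    ext y
    simp [hf]

theorem mainTheorem8 {V : Type*} (T : LFRootedTree V) (G : Subgroup T.Aut)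
    (hGfg : Group.FG G) (hG : LFRootedTree.IsBranch G)
    {X : Type*} [TopologicalSpace X] [CompactSpace X] (H : Subgroup (X ≃ₜ X))
    (S : Set H) (hSfin : S.Finite) (hSsymm : ∀ s ∈ S, s⁻¹ ∈ S)
    (hSgen : Subgroup.closure S = ⊤)
    (d : ℕ) (hd : (⨆ x : X, leud (graphOfGerms H.subtype S x)) ≤ (d : ℕ∞))
    (ρ : G →* H) (hρ : Function.Injective ρ) :
    ∃ q : LFRootedTree.essentialSupport G (H.subtype.comp ρ) → Config T.Boundary d,
      Config.IsUpperSemicontinuous q ∧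
      (∀ (g : G) (y : LFRootedTree.essentialSupport G (H.subtype.comp ρ)),
        (q ⟨H.subtype.comp ρ g y, LFRootedTree.essentialSupport_mapsTo _ g y.2⟩).1
          = (fun ξ => g • ξ) '' (q y).1) ∧
      (d = 1 → Continuous q ∧
        ∃ f : LFRootedTree.essentialSupport G (H.subtype.comp ρ) → T.Boundary,
          Continuous f ∧ ∀ y, (q y).1 = {f y}) := by

  have hcard : ∀ y : X, (LFRootedTree.supportRays (H.subtype.comp ρ) y).encard ≤ (d : ℕ∞) := by
    intro y
    by_contra! hlt
    -- More than `d` rays would include `d + 1` distinct ones, forcing leud at least `d + 1` at `y`.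
    obtain ⟨t, ht, htc⟩ := Set.exists_subset_encard_eq (Order.add_one_le_of_lt hlt)
    have htfin : t.Finite := Set.finite_of_encard_eq_coe (k := d + 1) (by exact_mod_cast htc)
    have hncard : Nat.card t = d + 1 := by
      rw [Nat.card_coe_set_eq, Set.ncard, htc]
      rfl
    have : Finite t := htfin
    let e := (Finite.equivFinOfCardEq hncard).symm
    have h1 := LFRootedTree.le_leud_graphOfGerms hGfg hG H hSgen ρ (y := y)
      (η := fun i => (e i).1) (Subtype.val_injective.comp e.injective)
      fun i => ht (e i).2
    have h2 := h1.trans ((le_iSup (fun x => leud (graphOfGerms H.subtype S x)) y).trans hd)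
    exact absurd (Nat.cast_le.1 h2) (by omega)
  let q : LFRootedTree.essentialSupport G (H.subtype.comp ρ) → Config T.Boundary d := fun y =>
    ⟨LFRootedTree.supportRays (H.subtype.comp ρ) y.1,
      LFRootedTree.supportRays_nonempty _ y.2, hcard y.1⟩
  have husc : Config.IsUpperSemicontinuous q :=
    Config.isUpperSemicontinuous_of_isClosed
      ((LFRootedTree.isClosed_supportRays (H.subtype.comp ρ)).preimage
        ((continuous_subtype_val.comp continuous_fst).prodMk continuous_snd))
  exact ⟨q, husc, fun g y => LFRootedTree.supportRays_apply _ g y.1,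
    fun h => husc.continuous_of_one h⟩
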